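/- Consider the energy buffer of relay R2 as a discrete-time Markov chain with continuous state space. Let $\lambda_2>0$, $M_{R2}>0$, $R_0>0$, $W_{SD}>0$, $W_{R2D}>0$, and put $\Gamma_{th}=2^{R_0}-1$. In each time slot $i$ the following are drawn independently of each other, of the other slots and of the initial level $B_2(0)\ge 0$: the transmitter candidate state $TC(i)\in\{\{S\},\{S,R1\},\{S,R2\},(S,R1,R2)_1,(S,R1,R2)_2,(S,R1,R2)_3\}$, with probabilities $p_S,p_{SR1},p_{SR2},p_1,p_2,p_3$; the signal-to-noise ratios (SNRs) $\gamma_{overall2}(i),\gamma_{overall3}(i)\in[0,\Gamma_{th})$ already accumulated at the destination D when the candidates are $\{S,R2\}$, respectively $\{S,R1,R2\}$ (in any of its three variants), with given laws that do not depend on $i$; the link SNRs $\gamma_{SD}(i)\sim\mathrm{Exp}(W_{SD})$ and $\gamma_{R2D}(i)\sim\mathrm{Exp}(W_{R2D})$; and the harvested energy $X(i)\sim\mathrm{Exp}(\lambda_2)$, of mean $1/\lambda_2$. Let $$\mathbb M_i=\{\gamma_{overall2}(i)+\gamma_{SD}(i)<\Gamma_{th}\},\quad \mathbb N_i=\{\gamma_{overall2}(i)+\gamma_{R2D}(i)<\Gamma_{th}\},$$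 $$\mathbb O_i=\{\gamma_{overall3}(i)+\gamma_{SD}(i)<\Gamma_{th}\},\quad \mathbb F_i=\{\gamma_{overall3}(i)+\gamma_{R2D}(i)<\Gamma_{th}\},$$ with probabilities $\mathfrak m,\mathfrak n,\mathfrak o,\mathfrak f$. The buffer level evolves by $B_2(i+1)=B_2(i)-M_{R2}+X(i)$ if $B_2(i)\ge M_{R2}$ and either $TC(i)=\{S,R2\}$ and $\mathbb M_i\cap\overline{\mathbb N_i}$ occurs, or $TC(i)=\{S,R1,R2\}$ (any variant) and $\mathbb O_i\cap\overline{\mathbb F_i}$ occurs; otherwise $B_2(i+1)=B_2(i)+X(i)$. Let $$\psi_{R2}=\lambda_2M_{R2}b_2,\qquad b_2=p_{SR2}\,\mathfrak m(1-\mathfrak n)+(p_1+p_2+p_3)\,\mathfrak o(1-\mathfrak f).$$ Suppose $\psi_{R2}\le 1$. Then: 1. The chain $B_2$ has no stationary probability distribution (in particular, no stationary PDF). 2. If the laws of $\gamma_{overall2}$ and $\gamma_{overall3}$ have no atoms, or if $\psi_{R2}<1$, then almost surely there is a finite $N$ such that $B_2(i)>M_{R2}$ for all $i\ge N$. 3.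 Without the proviso of 2 (so also when $\psi_{R2}=1$ and the laws have atoms), $B_2(i)>M_{R2}$ holds almost always: almost surely, the fraction of the slots $i<n$ with $B_2(i)>M_{R2}$ tends to $1$ as $n\to\infty$. -/

import Mathlib

open MeasureTheory ProbabilityTheory Filter
open scoped Topology

/-- The six transmitter candidate states: `{S}`, `{S,R1}`, `{S,R2}` and the three variants
`(S,R1,R2)₁`, `(S,R1,R2)₂`, `(S,R1,R2)₃` of `{S,R1,R2}`. -/
inductive TCState where
  | S | SR1 | SR2 | P1 | P2 | P3

instance : MeasurableSpace TCState := ⊤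

/-- The parameters on which the energy buffer of the relay R2 depends. -/
structure RelayParams where
  /-- rate of the exponential harvest of R2 (mean `1 / lam`) -/
  lam : ℝ
  lam_pos : 0 < lam
  /-- energy that R2 spends on one transmission -/
  M : ℝ
  M_pos : 0 < M
  /-- target data rate -/
  R₀ : ℝ
  R₀_pos : 0 < R₀
  /-- rate of the exponential SNR of the link S-D -/
  WSD : ℝ
  WSD_pos : 0 < WSD
  /-- rate of the exponential SNR of the link R2-D -/
  WR2D : ℝ
  WR2D_pos : 0 < WR2D
  /-- occurrence probabilities of the transmitter candidate states -/
  p : PMF TCState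
  /-- law of the SNR accumulated at D when the candidates are `{S,R2}` -/
  overall2 : Measure ℝ
  overall2_prob : IsProbabilityMeasure overall2
  overall2_mem : ∀ᵐ x ∂overall2, x ∈ Set.Ico (0 : ℝ) (2 ^ R₀ - 1)
  /-- law of the SNR accumulated at D when the candidates are `{S,R1,R2}` -/
  overall3 : Measure ℝ
  overall3_prob : IsProbabilityMeasure overall3
  overall3_mem : ∀ᵐ x ∂overall3, x ∈ Set.Ico (0 : ℝ) (2 ^ R₀ - 1)

/-- The random data of one time slot: candidate state, accumulated SNR for `{S,R2}`,
accumulated SNR for `{S,R1,R2}`, SNR of S-D, SNR of R2-D, harvested energy of R2. -/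
abbrev Slot : Type := TCState × ℝ × ℝ × ℝ × ℝ × ℝ

namespace Slot

def tc (s : Slot) : TCState := s.1
def overall2 (s : Slot) : ℝ := s.2.1
def overall3 (s : Slot) : ℝ := s.2.2.1
def snrSD (s : Slot) : ℝ := s.2.2.2.1
def snrR2D (s : Slot) : ℝ := s.2.2.2.2.1
def harvest (s : Slot) : ℝ := s.2.2.2.2.2

end Slot

namespace RelayParams

noncomputable section

/-- The SNR threshold `2 ^ R₀ - 1`. -/
def threshold (P : RelayParams) : ℝ := 2 ^ P.R₀ - 1

/-- The joint law of the data of one time slot; its components are independent. -/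
def slotLaw (P : RelayParams) : Measure Slot :=
  P.p.toMeasure.prod (P.overall2.prod (P.overall3.prod
    ((expMeasure P.WSD).prod ((expMeasure P.WR2D).prod (expMeasure P.lam)))))

/-- S fails to reach D when the candidates are `{S,R2}`. -/
def eventM (P : RelayParams) : Set Slot := {s | s.overall2 + s.snrSD < P.threshold}

/-- R2 fails to reach D when the candidates are `{S,R2}`. -/
def eventN (P : RelayParams) : Set Slot := {s | s.overall2 + s.snrR2D < P.threshold}

/-- S fails to reach D when the candidates are `{S,R1,R2}`. -/
def eventO (P : RelayParams) : Set Slot := {s | s.overall3 + s.snrSD < P.threshold}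

/-- R2 fails to reach D when the candidates are `{S,R1,R2}`. -/
def eventF (P : RelayParams) : Set Slot := {s | s.overall3 + s.snrR2D < P.threshold}

/-- The candidates are `{S,R1,R2}`, in any of the three variants. -/
def isSR1R2 (s : Slot) : Prop := s.tc = .P1 ∨ s.tc = .P2 ∨ s.tc = .P3

/-- R2 is the node that has to transmit, provided that its buffer holds enough energy. -/
def selectsR2 (P : RelayParams) : Set Slot :=
  {s | (s.tc = .SR2 ∧ s ∈ P.eventM ∧ s ∉ P.eventN) ∨
    (isSR1R2 s ∧ s ∈ P.eventO ∧ s ∉ P.eventF)}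

open Classical in
/-- The buffer update: the harvest is added, and `M` is spent exactly when R2 transmits. -/
def step (P : RelayParams) (B : ℝ) (s : Slot) : ℝ :=
  if P.M ≤ B ∧ s ∈ P.selectsR2 then B - P.M + s.harvest else B + s.harvest

/-- `b₂ = p_{SR2} 𝔪 (1 - 𝔫) + (p₁ + p₂ + p₃) 𝔬 (1 - 𝔣)`. -/
def b₂ (P : RelayParams) : ℝ :=
  (P.p .SR2).toReal * (P.slotLaw.real P.eventM * (1 - P.slotLaw.real P.eventN)) +
    ((P.p .P1).toReal + (P.p .P2).toReal + (P.p .P3).toReal) *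
      (P.slotLaw.real P.eventO * (1 - P.slotLaw.real P.eventF))

/-- The convergence parameter of the energy buffer of R2. -/
def psi (P : RelayParams) : ℝ := P.lam * P.M * P.b₂

instance instIsProbabilityMeasureSlotLaw (P : RelayParams) : IsProbabilityMeasure P.slotLaw := by
  have := P.overall2_prob
  have := P.overall3_prob
  have := isProbabilityMeasure_expMeasure P.WSD_pos
  have := isProbabilityMeasure_expMeasure P.WR2D_pos
  have := isProbabilityMeasure_expMeasure P.lam_pos
  unfold slotLaw
  infer_instance

theorem measurableSet_selectsR2 (P : RelayParams) : MeasurableSet P.selectsR2 := by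
  have htc : ∀ t : TCState, MeasurableSet {s : Slot | s.tc = t} := fun t =>
    (measurable_fst : Measurable (fun s : Slot => s.1)) (MeasurableSpace.measurableSet_top (s := {t}))
  have hM : MeasurableSet P.eventM :=
    measurableSet_lt (by unfold Slot.overall2 Slot.snrSD; fun_prop) measurable_const
  have hN : MeasurableSet P.eventN :=
    measurableSet_lt (by unfold Slot.overall2 Slot.snrR2D; fun_prop) measurable_const
  have hO : MeasurableSet P.eventO :=
    measurableSet_lt (by unfold Slot.overall3 Slot.snrSD; fun_prop) measurable_const
  have hF : MeasurableSet P.eventF :=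
    measurableSet_lt (by unfold Slot.overall3 Slot.snrR2D; fun_prop) measurable_const
  exact ((htc _).inter (hM.inter hN.compl)).union
    (((htc _).union ((htc _).union (htc _))).inter (hO.inter hF.compl))

theorem measurable_step (P : RelayParams) :
    Measurable (fun q : ℝ × Slot => P.step q.1 q.2) := by
  unfold step
  refine Measurable.ite ?_ ?_ ?_
  · exact (measurableSet_le measurable_const measurable_fst).inter
      (measurable_snd P.measurableSet_selectsR2)
  · unfold Slot.harvest; fun_prop
  · unfold Slot.harvest; fun_prop

/-- The transition kernel of the buffer level, a discrete-time Markov chain with a continuous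
state space. -/
def transition (P : RelayParams) : Kernel ℝ ℝ :=
  (Kernel.id ×ₖ Kernel.const ℝ P.slotLaw).map (fun q : ℝ × Slot => P.step q.1 q.2)

theorem transition_apply (P : RelayParams) (x : ℝ) :
    P.transition x = P.slotLaw.map (P.step x) := by
  rw [transition, Kernel.map_apply _ P.measurable_step, Kernel.prod_apply, Kernel.id_apply,
    Kernel.const_apply, Measure.dirac_prod, Measure.map_map P.measurable_step (by fun_prop)]
  rfl

/-- `B i` is the energy level of the buffer of R2 in slot `i`: it starts at an arbitrary
nonnegative random level and is driven by independent slots. -/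
structure IsBufferEvolution (P : RelayParams) {Ω : Type*} [MeasurableSpace Ω] (μ : Measure Ω)
    (B : ℕ → Ω → ℝ) (ξ : ℕ → Ω → Slot) : Prop where
  measurable_init : Measurable (B 0)
  init_nonneg : ∀ᵐ ω ∂μ, 0 ≤ B 0 ω
  measurable_slot : ∀ i, Measurable (ξ i)
  law_slot : ∀ i, μ.map (ξ i) = P.slotLaw
  indep_slots : iIndepFun ξ μ
  indep_init : IndepFun (B 0) (fun ω i => ξ i ω) μ
  update : ∀ i ω, B (i + 1) ω = P.step (B i ω) (ξ i ω)

end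

end RelayParams

/-! Let q = `selectProb` be the true probability that a slot selects R2. The events whose
probabilities are multiplied in `b₂` are not independent, because both links share the accumulated
SNR: as it grows, failure of S-D becomes less likely and success of R2-D more likely. Chebyshev's
association inequality gives q ≤ `b₂` (`selectProb_le_b₂`), so λMq ≤ ψ ≤ 1, and λMq < 1 under either
proviso of the second claim (`lam_mul_M_mul_selectProb_lt_one`).

Stationarity forces increments of mean zero, even for a level without a mean
(`integral_sub_eq_zero_of_map_eq`), hence 1 = λMq · ν[M, ∞). As λMq ≤ 1, the level would never be
below M; but just above M a selection with a small harvest leads below it (`not_exists_invariant`).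

Along a path, the level is a random walk of drift 1/λ - qM plus a refund M for every selection made
while the level is below M (`level_eq`). If λMq < 1, the walk alone tends to infinity. If λMq = 1,
the walk is o(n), and since refunds occur only at low levels, a reflection argument makes their
total o(n) (`tendsto_reflection_average`). Each slot is independent of the current level, so a
strong law for orthogonal variables shows that the refunds number q times the low slots, up to o(n)
(`ae_tendsto_low_selection`). Low slots therefore have density zero, and after slot 0 the level is
almost surely never exactly M. -/

/-! ### Exponential laws, association, equal laws, independence. -/

section General

/-- The mean of the exponential distribution. -/
theorem integral_id_expMeasure {r : ℝ} (hr : 0 < r) : ∫ x, x ∂(expMeasure r) = 1 / r := by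
  have h1 : ∫ x, x ∂(expMeasure r) = ∫ x, (exponentialPDF r x).toReal • x := by
    refine integral_withDensity_eq_integral_toReal_smul (μ := volume) (f := exponentialPDF r) ?_ ?_ _
    · exact (measurable_exponentialPDFReal r).ennreal_ofReal
    · exact ae_of_all _ fun x => by simp [exponentialPDF]
  -- The exponent is written 2 - 1 to match the Gamma integral at 2; the point 0 may be dropped
  -- because the integrand vanishes there.
  have h2 : (fun x => (exponentialPDF r x).toReal • x) =
      (Set.Ioi (0 : ℝ)).indicator (fun x => r * (x ^ ((2 : ℝ) - 1) * Real.exp (-(r * x)))) := by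
    ext x
    rcases lt_trichotomy x 0 with hx | hx | hx
    · rw [exponentialPDF_of_neg hx, Set.indicator_of_notMem (by simp [hx.le])]; simp
    · simp [hx]
    · rw [exponentialPDF_of_nonneg hx.le, Set.indicator_of_mem (by simp [hx]),
        ENNReal.toReal_ofReal (by positivity)]
      norm_num
      ring
  rw [h1, h2, integral_indicator measurableSet_Ioi, integral_const_mul,
    Real.integral_rpow_mul_exp_neg_mul_Ioi (by norm_num) hr]
  have : Real.Gamma 2 = 1 := by simp
  rw [this]
  norm_num
  field_simp

/-- A non-integrable function has Bochner integral 0 by convention, whereas this mean is positive.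
-/
theorem integrable_id_expMeasure {r : ℝ} (hr : 0 < r) :
    Integrable (fun x : ℝ => x) (expMeasure r) := by
  by_contra h
  have h1 := integral_id_expMeasure hr
  rw [integral_undef h] at h1
  have : 0 < 1 / r := by positivity
  linarith

theorem nullSingletonClass_expMeasure (r : ℝ) : NullSingletonClass (expMeasure r) :=
  inferInstanceAs (NullSingletonClass (volume.withDensity (gammaPDF 1 r)))

theorem expMeasure_real_Iio {r : ℝ} (hr : 0 < r) {x : ℝ} (hx : 0 ≤ x) :
    (expMeasure r).real (Set.Iio x) = 1 - Real.exp (-(r * x)) := by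
  have := isProbabilityMeasure_expMeasure hr
  have := nullSingletonClass_expMeasure r
  rw [← measureReal_congr (Iio_ae_eq_Iic (a := x)).symm, ← cdf_eq_real,
    cdf_expMeasure_eq hr, if_pos hx]

theorem expMeasure_Iio_pos {r : ℝ} (hr : 0 < r) {x : ℝ} (hx : 0 < x) :
    0 < expMeasure r (Set.Iio x) := by
  have h := expMeasure_real_Iio hr hx.le
  have h2 : 0 < (expMeasure r).real (Set.Iio x) := by
    rw [h, sub_pos, Real.exp_lt_one_iff, neg_lt_zero]; positivity
  exact (ENNReal.toReal_pos_iff.1 h2).1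

section Association

variable {α : Type*} [MeasurableSpace α] {ν : Measure α} [IsProbabilityMeasure ν] {F G : α → ℝ}

/-- Twice the covariance, as an integral over two independent copies. -/
theorem integral_prod_sub_mul_sub (hF : Integrable F ν) (hG : Integrable G ν)
    (hFG : Integrable (fun x => F x * G x) ν) :
    Integrable (fun z : α × α => (F z.1 - F z.2) * (G z.1 - G z.2)) (ν.prod ν) ∧
    ∫ z, (F z.1 - F z.2) * (G z.1 - G z.2) ∂(ν.prod ν) =
      2 * (∫ x, F x * G x ∂ν - (∫ x, F x ∂ν) * ∫ x, G x ∂ν) := by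
  have i1 : Integrable (fun z : α × α => F z.1 * G z.1) (ν.prod ν) := hFG.comp_fst ν
  have i2 : Integrable (fun z : α × α => F z.2 * G z.2) (ν.prod ν) := hFG.comp_snd ν
  have i3 : Integrable (fun z : α × α => F z.1 * G z.2) (ν.prod ν) := hF.mul_prod hG
  have i4 : Integrable (fun z : α × α => G z.1 * F z.2) (ν.prod ν) := hG.mul_prod hF
  have he : (fun z : α × α => (F z.1 - F z.2) * (G z.1 - G z.2)) = fun z =>
      (F z.1 * G z.1 + F z.2 * G z.2) - (F z.1 * G z.2 + G z.1 * F z.2) := by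
    ext z; ring
  rw [he]
  refine ⟨(i1.add i2).sub (i3.add i4), ?_⟩
  have e := integral_sub (i1.add i2) (i3.add i4)
  simp only [Pi.add_apply] at e
  rw [e, integral_add i1 i2, integral_add i3 i4, integral_prod_mul, integral_prod_mul, integral_fun_fst (fun x => F x * G x),
    integral_fun_snd (fun x => F x * G x)]
  simp
  ring

/-- Chebyshev's association inequality for oppositely ordered functions. -/
theorem integral_mul_le_of_antivary (hF : Integrable F ν) (hG : Integrable G ν)
    (hFG : Integrable (fun x => F x * G x) ν) (h : Antivary F G) :
    ∫ x, F x * G x ∂ν ≤ (∫ x, F x ∂ν) * ∫ x, G x ∂ν := by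
  obtain ⟨-, h2⟩ := integral_prod_sub_mul_sub hF hG hFG
  have h3 : ∫ z, (F z.1 - F z.2) * (G z.1 - G z.2) ∂(ν.prod ν) ≤ 0 :=
    integral_nonpos fun z => by
      -- `Antivary` constrains `F` only where `G` differs strictly; where `G` agrees the product is
      -- zero.
      rcases lt_trichotomy (G z.1) (G z.2) with hz | hz | hz
      · exact mul_nonpos_of_nonneg_of_nonpos (sub_nonneg.2 (h hz)) (sub_nonpos.2 hz.le)
      · simp [hz]
      · exact mul_nonpos_of_nonpos_of_nonneg (sub_nonpos.2 (h hz)) (sub_nonneg.2 hz.le)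
  linarith

/-- Strict form of Chebyshev's association inequality. -/
theorem integral_mul_lt_of_ae_prod (hF : Integrable F ν) (hG : Integrable G ν)
    (hFG : Integrable (fun x => F x * G x) ν)
    (h : ∀ᵐ z ∂(ν.prod ν), (F z.1 - F z.2) * (G z.1 - G z.2) < 0) :
    ∫ x, F x * G x ∂ν < (∫ x, F x ∂ν) * ∫ x, G x ∂ν := by
  obtain ⟨h1, h2⟩ := integral_prod_sub_mul_sub hF hG hFG
  have h3 : ∫ z, (F z.1 - F z.2) * (G z.1 - G z.2) ∂(ν.prod ν) < 0 := by
    have h4 : 0 < ∫ z, -((F z.1 - F z.2) * (G z.1 - G z.2)) ∂(ν.prod ν) := by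
      refine (integral_pos_iff_support_of_nonneg_ae ?_ h1.neg).2 ?_
      · filter_upwards [h] with z hz
        simpa using hz.le
      · have : (Function.support fun z : α × α => -((F z.1 - F z.2) * (G z.1 - G z.2)))
            =ᵐ[ν.prod ν] Set.univ := by
          filter_upwards [h] with z hz
          have : z ∈ Function.support fun z : α × α => -((F z.1 - F z.2) * (G z.1 - G z.2)) := by
            simp only [Function.mem_support, ne_eq, neg_eq_zero]; exact hz.ne
          exact propext ⟨fun _ => trivial, fun _ => this⟩
        exact (measure_congr this).symm ▸ by simp
    rw [integral_neg] at h4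
    linarith
  linarith

/-- By Fubini: the sections of the diagonal are singletons. -/
theorem ae_prod_fst_ne_snd {ν : Measure ℝ} [IsProbabilityMeasure ν] (h : ∀ x, ν {x} = 0) :
    ∀ᵐ z : ℝ × ℝ ∂(ν.prod ν), z.1 ≠ z.2 := by
  have hm : MeasurableSet {z : ℝ × ℝ | z.1 ≠ z.2} :=
    (measurableSet_eq_fun measurable_fst measurable_snd).compl
  rw [Measure.ae_prod_iff_ae_ae hm]
  refine ae_of_all _ fun x => ?_
  rw [ae_iff]
  convert h x using 2
  ext y
  simp [eq_comm]

end Association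

/-- If two random variables have the same law and an integrable difference, then that difference
has mean zero, whether or not the variables are integrable. -/
theorem integral_sub_eq_zero_of_map_eq {Ω : Type*} [MeasurableSpace Ω] {μ : Measure Ω}
    [IsFiniteMeasure μ] {X Y : Ω → ℝ} (hX : Measurable X) (hY : Measurable Y)
    (h : μ.map X = μ.map Y) (hi : Integrable (fun ω => Y ω - X ω) μ) :
    ∫ ω, (Y ω - X ω) ∂μ = 0 := by
  -- Clamping to [-n, n] gives variables with equal finite means. It is 1-Lipschitz, so `|Y - X|`
  -- dominates the clamped differences.
  let T : ℕ → ℝ → ℝ := fun n x => max (-(n : ℝ)) (min x n)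
  have hTm : ∀ n, Measurable (T n) := fun n => by unfold T; fun_prop
  have hTb : ∀ n x, ‖T n x‖ ≤ n := fun n x => by
    rw [Real.norm_eq_abs, abs_le]
    refine ⟨le_max_left _ _, max_le ?_ (min_le_right _ _)⟩
    have : (0 : ℝ) ≤ n := n.cast_nonneg
    linarith
  have hTi : ∀ n (Z : Ω → ℝ), Measurable Z → Integrable (fun ω => T n (Z ω)) μ := fun n Z hZ =>
    Integrable.of_bound ((hTm n).comp hZ).aestronglyMeasurable n (ae_of_all _ fun ω => hTb n _)
  have hTeq : ∀ x, ∀ᶠ n : ℕ in atTop, T n x = x := fun x => by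
    obtain ⟨N, hN⟩ := exists_nat_ge |x|
    filter_upwards [eventually_ge_atTop N] with n hn
    have hn' : |x| ≤ n := hN.trans (by exact_mod_cast hn)
    obtain ⟨h1, h2⟩ := abs_le.1 hn'
    simp [T, h1, h2]
  have h0 : ∀ n, ∫ ω, (T n (Y ω) - T n (X ω)) ∂μ = 0 := fun n => by
    rw [integral_sub (hTi n Y hY) (hTi n X hX),
      ← integral_map hY.aemeasurable (hTm n).aestronglyMeasurable,
      ← integral_map hX.aemeasurable (hTm n).aestronglyMeasurable, h, sub_self]
  have hlim : Tendsto (fun n => ∫ ω, (T n (Y ω) - T n (X ω)) ∂μ) atTop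
      (𝓝 (∫ ω, (Y ω - X ω) ∂μ)) := by
    refine tendsto_integral_of_dominated_convergence (fun ω => ‖Y ω - X ω‖)
      (fun n => ((hTi n Y hY).sub (hTi n X hX)).aestronglyMeasurable) hi.norm
      (fun n => ae_of_all _ fun ω => ?_) (ae_of_all _ fun ω => ?_)
    · rw [Real.norm_eq_abs, Real.norm_eq_abs]
      refine (abs_max_sub_max_le_max _ _ _ _).trans (max_le (by simp) ?_)
      exact (abs_min_sub_min_le_max _ _ _ _).trans (by simp)
    · refine tendsto_const_nhds.congr' ?_
      filter_upwards [hTeq (X ω), hTeq (Y ω)] with n h1 h2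
      rw [h1, h2]
  simp only [h0] at hlim
  exact (tendsto_nhds_unique hlim tendsto_const_nhds)

theorem indepFun_prodMk_left {Ω α β γ : Type*} [MeasurableSpace Ω] [MeasurableSpace α]
    [MeasurableSpace β] [MeasurableSpace γ] {μ : Measure Ω} [IsProbabilityMeasure μ]
    {X : Ω → α} {Y : Ω → β} {Z : Ω → γ} (hX : Measurable X) (hY : Measurable Y)
    (hZ : Measurable Z) (h1 : IndepFun X (fun ω => (Y ω, Z ω)) μ) (h2 : IndepFun Y Z μ) :
    IndepFun (fun ω => (X ω, Y ω)) Z μ := by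
  have h3 : IndepFun X Y μ := h1.comp measurable_id measurable_fst
  have := Measure.isProbabilityMeasure_map (μ := μ) hX.aemeasurable
  have := Measure.isProbabilityMeasure_map (μ := μ) hY.aemeasurable
  have := Measure.isProbabilityMeasure_map (μ := μ) hZ.aemeasurable
  rw [indepFun_iff_map_prod_eq_prod_map_map (by fun_prop) (by fun_prop)] at *
  have e : (fun ω => ((X ω, Y ω), Z ω)) =
      (MeasurableEquiv.prodAssoc : (α × β) × γ ≃ᵐ α × β × γ).symm ∘
        fun ω => (X ω, (Y ω, Z ω)) := rfl
  rw [e, ← Measure.map_map (MeasurableEquiv.measurable _) (by fun_prop), h1, h2, h3,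
    ← Measure.prodAssoc_prod, MeasurableEquiv.map_symm_map]

end General

/-! ### Two links that share an accumulated SNR. -/

section Link

theorem antitone_measureReal_Iio_sub {σ : Measure ℝ} [IsFiniteMeasure σ] (Γ : ℝ) :
    Antitone fun a => σ.real (Set.Iio (Γ - a)) :=
  fun _ _ h => measureReal_mono (Set.Iio_subset_Iio (by linarith))

theorem monotone_measureReal_Ici_sub {τ : Measure ℝ} [IsFiniteMeasure τ] (Γ : ℝ) :
    Monotone fun a => τ.real (Set.Ici (Γ - a)) :=
  fun _ _ h => measureReal_mono (Set.Ici_subset_Ici.2 (by linarith))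

/-- Given the shared first coordinate, the two conditions are independent. -/
theorem measureReal_prod_prod_eq_integral {ν σ τ : Measure ℝ} [SFinite ν]
    [IsFiniteMeasure σ] [IsFiniteMeasure τ] {C D : ℝ → Set ℝ}
    (h : MeasurableSet {z : ℝ × ℝ × ℝ | z.2.1 ∈ C z.1 ∧ z.2.2 ∈ D z.1}) :
    (ν.prod (σ.prod τ)).real {z | z.2.1 ∈ C z.1 ∧ z.2.2 ∈ D z.1} =
      ∫ a, σ.real (C a) * τ.real (D a) ∂ν := by
  have e : ∀ a, (σ.prod τ) (Prod.mk a ⁻¹' {z | z.2.1 ∈ C z.1 ∧ z.2.2 ∈ D z.1}) =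
      σ (C a) * τ (D a) := fun a => by
    rw [← Measure.prod_prod]; rfl
  rw [measureReal_def, Measure.prod_apply h, ← integral_toReal
    (measurable_measure_prodMk_left h).aemeasurable (ae_of_all _ fun a => measure_lt_top _ _)]
  refine integral_congr_ae (ae_of_all _ fun a => ?_)
  simp only [e, ENNReal.toReal_mul, measureReal_def]

variable {ν σ τ : Measure ℝ} [IsProbabilityMeasure ν] [IsProbabilityMeasure σ]
  [IsProbabilityMeasure τ]

theorem measureReal_fst_fail (Γ : ℝ) :
    (ν.prod (σ.prod τ)).real {z | z.1 + z.2.1 < Γ} = ∫ a, σ.real (Set.Iio (Γ - a)) ∂ν := by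
  have h := measureReal_prod_prod_eq_integral (ν := ν) (σ := σ) (τ := τ)
    (C := fun a => Set.Iio (Γ - a)) (D := fun _ => Set.univ) (by
      simp only [Set.mem_Iio, Set.mem_univ, and_true]
      exact measurableSet_lt (by fun_prop) (by fun_prop))
  simpa [lt_sub_iff_add_lt'] using h

theorem one_sub_measureReal_snd_fail (Γ : ℝ) :
    1 - (ν.prod (σ.prod τ)).real {z | z.1 + z.2.2 < Γ} = ∫ a, τ.real (Set.Ici (Γ - a)) ∂ν := by
  have h := measureReal_prod_prod_eq_integral (ν := ν) (σ := σ) (τ := τ)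
    (C := fun _ => Set.univ) (D := fun a => Set.Ici (Γ - a)) (by
      simp only [Set.mem_Ici, Set.mem_univ, true_and]
      exact measurableSet_le (by fun_prop) (by fun_prop))
  rw [← probReal_compl_eq_one_sub (measurableSet_lt (by fun_prop) (by fun_prop))]
  simpa [Set.compl_ofPred, -tsub_le_iff_right, sub_le_iff_le_add'] using h

theorem measureReal_fst_fail_snd_success (Γ : ℝ) :
    (ν.prod (σ.prod τ)).real {z | z.1 + z.2.1 < Γ ∧ ¬ z.1 + z.2.2 < Γ} =
      ∫ a, σ.real (Set.Iio (Γ - a)) * τ.real (Set.Ici (Γ - a)) ∂ν := by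
  have h := measureReal_prod_prod_eq_integral (ν := ν) (σ := σ) (τ := τ)
    (C := fun a => Set.Iio (Γ - a)) (D := fun a => Set.Ici (Γ - a)) (by
      simp only [Set.mem_Ici, Set.mem_Iio]
      exact MeasurableSet.inter
        (measurableSet_lt (f := fun z : ℝ × ℝ × ℝ => z.2.1) (by fun_prop) (by fun_prop))
        (measurableSet_le (g := fun z : ℝ × ℝ × ℝ => z.2.2) (by fun_prop) (by fun_prop)))
  simpa [lt_sub_iff_add_lt', -tsub_le_iff_right, sub_le_iff_le_add'] using h

theorem integrable_measureReal_Iio_sub (Γ : ℝ) :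
    Integrable (fun a => σ.real (Set.Iio (Γ - a))) ν :=
  Integrable.of_bound (antitone_measureReal_Iio_sub Γ).measurable.aestronglyMeasurable 1
    (ae_of_all _ fun a => by simp [abs_of_nonneg measureReal_nonneg, measureReal_le_one])

theorem integrable_measureReal_Ici_sub (Γ : ℝ) :
    Integrable (fun a => τ.real (Set.Ici (Γ - a))) ν :=
  Integrable.of_bound (monotone_measureReal_Ici_sub Γ).measurable.aestronglyMeasurable 1
    (ae_of_all _ fun a => by simp [abs_of_nonneg measureReal_nonneg, measureReal_le_one])

theorem integrable_measureReal_Iio_mul_Ici (Γ : ℝ) :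
    Integrable (fun a => σ.real (Set.Iio (Γ - a)) * τ.real (Set.Ici (Γ - a))) ν :=
  (integrable_measureReal_Ici_sub Γ).bdd_mul (c := 1)
    (antitone_measureReal_Iio_sub Γ).measurable.aestronglyMeasurable
    (ae_of_all _ fun a => by simp [abs_of_nonneg measureReal_nonneg, measureReal_le_one])

/-- Given a shared accumulated SNR, failure of the first link and success of the second one are
negatively correlated. -/
theorem measureReal_fst_fail_snd_success_le (Γ : ℝ) :
    (ν.prod (σ.prod τ)).real {z | z.1 + z.2.1 < Γ ∧ ¬ z.1 + z.2.2 < Γ} ≤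
      (ν.prod (σ.prod τ)).real {z | z.1 + z.2.1 < Γ} *
        (1 - (ν.prod (σ.prod τ)).real {z | z.1 + z.2.2 < Γ}) := by
  rw [measureReal_fst_fail_snd_success, measureReal_fst_fail, one_sub_measureReal_snd_fail]
  exact integral_mul_le_of_antivary (integrable_measureReal_Iio_sub Γ)
    (integrable_measureReal_Ici_sub Γ) (integrable_measureReal_Iio_mul_Ici Γ)
    ((antitone_measureReal_Iio_sub Γ).antivary (monotone_measureReal_Ici_sub Γ))

/-- For a < Γ the conditional probabilities 1 - exp(-r(Γ - a)) and exp(-s(Γ - a)) are strictly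
monotone in opposite directions, and without atoms two independent copies of a almost surely differ.
-/
theorem measureReal_fst_fail_snd_success_lt {ν : Measure ℝ} [IsProbabilityMeasure ν] {r s Γ : ℝ}
    (hr : 0 < r) (hs : 0 < s) (hΓ : ∀ᵐ x ∂ν, x < Γ) (hν : ∀ x, ν {x} = 0) :
    (ν.prod ((expMeasure r).prod (expMeasure s))).real
        {z | z.1 + z.2.1 < Γ ∧ ¬ z.1 + z.2.2 < Γ} <
      (ν.prod ((expMeasure r).prod (expMeasure s))).real {z | z.1 + z.2.1 < Γ} *
        (1 - (ν.prod ((expMeasure r).prod (expMeasure s))).real {z | z.1 + z.2.2 < Γ}) := by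
  have := isProbabilityMeasure_expMeasure hr
  have := isProbabilityMeasure_expMeasure hs
  rw [measureReal_fst_fail_snd_success, measureReal_fst_fail, one_sub_measureReal_snd_fail]
  refine integral_mul_lt_of_ae_prod (integrable_measureReal_Iio_sub Γ)
    (integrable_measureReal_Ici_sub Γ) (integrable_measureReal_Iio_mul_Ici Γ) ?_
  have h1 : ∀ᵐ z : ℝ × ℝ ∂(ν.prod ν), z.1 < Γ := Measure.quasiMeasurePreserving_fst.ae hΓ
  have h2 : ∀ᵐ z : ℝ × ℝ ∂(ν.prod ν), z.2 < Γ := Measure.quasiMeasurePreserving_snd.ae hΓ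
  have hF : ∀ x < Γ, (expMeasure r).real (Set.Iio (Γ - x)) = 1 - Real.exp (-(r * (Γ - x))) :=
    fun x hx => expMeasure_real_Iio hr (by linarith)
  have hG : ∀ x < Γ, (expMeasure s).real (Set.Ici (Γ - x)) = Real.exp (-(s * (Γ - x))) :=
    fun x hx => by
      rw [← Set.compl_Iio, probReal_compl_eq_one_sub measurableSet_Iio,
        expMeasure_real_Iio hs (by linarith)]
      ring
  filter_upwards [h1, h2, ae_prod_fst_ne_snd hν] with z h1 h2 h3
  rw [hF _ h1, hF _ h2, hG _ h1, hG _ h2]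
  rcases lt_or_gt_of_ne h3 with h | h
  · refine mul_neg_of_pos_of_neg ?_ ?_
    · rw [sub_pos]; gcongr
    · rw [sub_neg]; gcongr
  · refine mul_neg_of_neg_of_pos ?_ ?_
    · rw [sub_neg]; gcongr
    · rw [sub_pos]; gcongr

end Link

/-! ### The selection probability and its comparison with `b₂`. -/

namespace RelayParams

/-- The probability that R2 is selected in a slot. -/
noncomputable def selectProb (P : RelayParams) : ℝ := P.slotLaw.real P.selectsR2

theorem selectProb_nonneg (P : RelayParams) : 0 ≤ P.selectProb := measureReal_nonneg

theorem measurePreserving_tc_overall2 (P : RelayParams) :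
    MeasurePreserving (fun s : Slot => (s.tc, s.overall2, s.snrSD, s.snrR2D)) P.slotLaw
      (P.p.toMeasure.prod
        (P.overall2.prod ((expMeasure P.WSD).prod (expMeasure P.WR2D)))) := by
  have := P.overall2_prob
  have := P.overall3_prob
  have := isProbabilityMeasure_expMeasure P.WSD_pos
  have := isProbabilityMeasure_expMeasure P.WR2D_pos
  have := isProbabilityMeasure_expMeasure P.lam_pos
  exact (MeasurePreserving.id _).prod ((MeasurePreserving.id _).prod
    (((MeasurePreserving.id _).prod measurePreserving_fst).comp measurePreserving_snd))

theorem measurePreserving_tc_overall3 (P : RelayParams) :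
    MeasurePreserving (fun s : Slot => (s.tc, s.overall3, s.snrSD, s.snrR2D)) P.slotLaw
      (P.p.toMeasure.prod
        (P.overall3.prod ((expMeasure P.WSD).prod (expMeasure P.WR2D)))) := by
  have := P.overall2_prob
  have := P.overall3_prob
  have := isProbabilityMeasure_expMeasure P.WSD_pos
  have := isProbabilityMeasure_expMeasure P.WR2D_pos
  have := isProbabilityMeasure_expMeasure P.lam_pos
  exact (MeasurePreserving.id _).prod (((MeasurePreserving.id _).prod
    ((MeasurePreserving.id _).prod measurePreserving_fst)).comp measurePreserving_snd)

theorem measurePreserving_harvest (P : RelayParams) :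
    MeasurePreserving Slot.harvest P.slotLaw (expMeasure P.lam) := by
  have := P.overall2_prob
  have := P.overall3_prob
  have := isProbabilityMeasure_expMeasure P.WSD_pos
  have := isProbabilityMeasure_expMeasure P.WR2D_pos
  have := isProbabilityMeasure_expMeasure P.lam_pos
  exact measurePreserving_snd.comp (measurePreserving_snd.comp (measurePreserving_snd.comp
    (measurePreserving_snd.comp measurePreserving_snd)))

theorem measurable_harvest : Measurable Slot.harvest := by unfold Slot.harvest; fun_prop

/-- The link data that decide whether R2 is selected are the components other than the harvest. -/
theorem slotLaw_selectsR2_inter_harvest (P : RelayParams) {A : Set ℝ} (hA : MeasurableSet A) :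
    P.slotLaw (P.selectsR2 ∩ Slot.harvest ⁻¹' A) = P.slotLaw P.selectsR2 * expMeasure P.lam A := by
  have := P.overall2_prob
  have := P.overall3_prob
  have := isProbabilityMeasure_expMeasure P.WSD_pos
  have := isProbabilityMeasure_expMeasure P.WR2D_pos
  have := isProbabilityMeasure_expMeasure P.lam_pos
  have hmp : MeasurePreserving
      (fun s : Slot => ((s.tc, s.overall2, s.overall3, s.snrSD, s.snrR2D), s.harvest)) P.slotLaw
      ((P.p.toMeasure.prod (P.overall2.prod (P.overall3.prod
        ((expMeasure P.WSD).prod (expMeasure P.WR2D))))).prod (expMeasure P.lam)) := by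
    -- Reassociating from the innermost product outwards splits off the harvest as a separate
    -- factor.
    have a1 := (measurePreserving_prodAssoc (expMeasure P.WSD) (expMeasure P.WR2D)
      (expMeasure P.lam)).symm
    have a2 := (measurePreserving_prodAssoc P.overall3 ((expMeasure P.WSD).prod
      (expMeasure P.WR2D)) (expMeasure P.lam)).symm
    have a3 := (measurePreserving_prodAssoc P.overall2 (P.overall3.prod ((expMeasure P.WSD).prod
      (expMeasure P.WR2D))) (expMeasure P.lam)).symm
    have a4 := (measurePreserving_prodAssoc P.p.toMeasure (P.overall2.prod (P.overall3.prod
      ((expMeasure P.WSD).prod (expMeasure P.WR2D)))) (expMeasure P.lam)).symm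
    exact a4.comp ((MeasurePreserving.id _).prod (a3.comp ((MeasurePreserving.id _).prod
      (a2.comp ((MeasurePreserving.id _).prod a1)))))
  -- The harvest 0 is a dummy: selection does not look at that component. The case `A' = univ` below
  -- identifies the mass of `C`.
  let C : Set (TCState × ℝ × ℝ × ℝ × ℝ) :=
    {c | ((c.1, c.2.1, c.2.2.1, c.2.2.2.1, c.2.2.2.2, (0 : ℝ)) : Slot) ∈ P.selectsR2}
  have hC : MeasurableSet C := by
    have : Measurable (fun c : TCState × ℝ × ℝ × ℝ × ℝ =>
      ((c.1, c.2.1, c.2.2.1, c.2.2.2.1, c.2.2.2.2, (0 : ℝ)) : Slot)) := by fun_prop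
    exact this P.measurableSet_selectsR2
  have key : ∀ A' : Set ℝ, MeasurableSet A' → P.slotLaw (P.selectsR2 ∩ Slot.harvest ⁻¹' A') =
      (P.p.toMeasure.prod (P.overall2.prod (P.overall3.prod
        ((expMeasure P.WSD).prod (expMeasure P.WR2D))))) C * expMeasure P.lam A' := by
    intro A' hA'
    rw [← Measure.prod_prod, ← hmp.measure_preimage (hC.prod hA').nullMeasurableSet]
    rfl
  have h1 := key Set.univ MeasurableSet.univ
  simp only [Set.preimage_univ, Set.inter_univ, measure_univ, mul_one] at h1
  rw [key A hA, h1]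

/-- The probability, for a law `ν` of the accumulated SNR, that S fails and R2 succeeds. -/
noncomputable def relayProb (P : RelayParams) (ν : Measure ℝ) : ℝ :=
  (ν.prod ((expMeasure P.WSD).prod (expMeasure P.WR2D))).real
    {z | z.1 + z.2.1 < P.threshold ∧ ¬ z.1 + z.2.2 < P.threshold}

theorem measurableSet_fail_success (Γ : ℝ) :
    MeasurableSet {z : ℝ × ℝ × ℝ | z.1 + z.2.1 < Γ ∧ ¬ z.1 + z.2.2 < Γ} :=
  MeasurableSet.inter
    (measurableSet_lt (f := fun z : ℝ × ℝ × ℝ => z.1 + z.2.1) (by fun_prop) (by fun_prop))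
    (measurableSet_lt (f := fun z : ℝ × ℝ × ℝ => z.1 + z.2.2) (by fun_prop) (by fun_prop)).compl

theorem pmf_toMeasure_real_SR1R2 (p : PMF TCState) :
    p.toMeasure.real {t | t = .P1 ∨ t = .P2 ∨ t = .P3} =
      (p .P1).toReal + (p .P2).toReal + (p .P3).toReal := by
  have hs : ∀ t : TCState, MeasurableSet ({t} : Set TCState) :=
    fun t => MeasurableSpace.measurableSet_top
  have e : {t : TCState | t = .P1 ∨ t = .P2 ∨ t = .P3} = ({.P1} ∪ {.P2}) ∪ {.P3} := by
    ext t; simp only [Set.mem_union, Set.mem_singleton_iff, or_assoc]; rfl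
  rw [e, measureReal_union (by simp) (hs _), measureReal_union (by simp) (hs _)]
  simp only [measureReal_def, PMF.toMeasure_apply_singleton _ _ (hs _)]

/-- The two ways of being selected are disjoint, as they need different candidate states, and the
state is independent of the SNRs. -/
theorem selectProb_eq (P : RelayParams) :
    P.selectProb = (P.p .SR2).toReal * P.relayProb P.overall2 +
      ((P.p .P1).toReal + (P.p .P2).toReal + (P.p .P3).toReal) * P.relayProb P.overall3 := by
  have := P.overall2_prob
  have := P.overall3_prob
  have := isProbabilityMeasure_expMeasure P.WSD_pos
  have := isProbabilityMeasure_expMeasure P.WR2D_pos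
  have hs : ∀ T : Set TCState, MeasurableSet T := fun t => MeasurableSpace.measurableSet_top
  have h2 : P.slotLaw.real {s | s.tc = .SR2 ∧ s ∈ P.eventM ∧ s ∉ P.eventN} =
      (P.p .SR2).toReal * P.relayProb P.overall2 := by
    have h := P.measurePreserving_tc_overall2.measureReal_preimage
      ((hs {TCState.SR2}).prod (measurableSet_fail_success P.threshold)).nullMeasurableSet
    rw [measureReal_prod_prod, measureReal_def P.p.toMeasure,
      PMF.toMeasure_apply_singleton _ _ (hs _)] at h
    exact h
  have h3 : P.slotLaw.real {s | isSR1R2 s ∧ s ∈ P.eventO ∧ s ∉ P.eventF} =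
      ((P.p .P1).toReal + (P.p .P2).toReal + (P.p .P3).toReal) * P.relayProb P.overall3 := by
    have h := P.measurePreserving_tc_overall3.measureReal_preimage
      ((hs {t | t = .P1 ∨ t = .P2 ∨ t = .P3}).prod
        (measurableSet_fail_success P.threshold)).nullMeasurableSet
    rw [measureReal_prod_prod, pmf_toMeasure_real_SR1R2] at h
    exact h
  have hm : MeasurableSet {s | isSR1R2 s ∧ s ∈ P.eventO ∧ s ∉ P.eventF} :=
    P.measurePreserving_tc_overall3.measurable ((hs {t | t = .P1 ∨ t = .P2 ∨ t = .P3}).prod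
      (measurableSet_fail_success P.threshold))
  rw [← h2, ← h3, ← measureReal_union _ hm]
  · rfl
  · rw [Set.disjoint_left]
    rintro s ⟨hs, -⟩ ⟨hs', -⟩
    simp [isSR1R2, hs] at hs'

theorem b₂_eq (P : RelayParams) :
    P.b₂ = (P.p .SR2).toReal *
        ((P.overall2.prod ((expMeasure P.WSD).prod (expMeasure P.WR2D))).real
          {z | z.1 + z.2.1 < P.threshold} *
        (1 - (P.overall2.prod ((expMeasure P.WSD).prod (expMeasure P.WR2D))).real
          {z | z.1 + z.2.2 < P.threshold})) +
      ((P.p .P1).toReal + (P.p .P2).toReal + (P.p .P3).toReal) *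
        ((P.overall3.prod ((expMeasure P.WSD).prod (expMeasure P.WR2D))).real
          {z | z.1 + z.2.1 < P.threshold} *
        (1 - (P.overall3.prod ((expMeasure P.WSD).prod (expMeasure P.WR2D))).real
          {z | z.1 + z.2.2 < P.threshold})) := by
  have := P.overall2_prob
  have := P.overall3_prob
  have := isProbabilityMeasure_expMeasure P.WSD_pos
  have := isProbabilityMeasure_expMeasure P.WR2D_pos
  have hm1 : MeasurableSet {z : ℝ × ℝ × ℝ | z.1 + z.2.1 < P.threshold} :=
    measurableSet_lt (by fun_prop) (by fun_prop)
  have hm2 : MeasurableSet {z : ℝ × ℝ × ℝ | z.1 + z.2.2 < P.threshold} :=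
    measurableSet_lt (by fun_prop) (by fun_prop)
  have m2 := measurePreserving_snd.comp P.measurePreserving_tc_overall2
  have m3 := measurePreserving_snd.comp P.measurePreserving_tc_overall3
  rw [← m2.measureReal_preimage hm1.nullMeasurableSet,
    ← m2.measureReal_preimage hm2.nullMeasurableSet,
    ← m3.measureReal_preimage hm1.nullMeasurableSet,
    ← m3.measureReal_preimage hm2.nullMeasurableSet]
  rfl

theorem selectProb_le_b₂ (P : RelayParams) : P.selectProb ≤ P.b₂ := by
  have := P.overall2_prob
  have := P.overall3_prob
  have := isProbabilityMeasure_expMeasure P.WSD_pos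
  have := isProbabilityMeasure_expMeasure P.WR2D_pos
  rw [selectProb_eq, b₂_eq]
  gcongr
  · exact measureReal_fst_fail_snd_success_le _
  · exact measureReal_fst_fail_snd_success_le _

theorem lam_mul_M_mul_selectProb_le (P : RelayParams) : P.lam * P.M * P.selectProb ≤ P.psi :=
  mul_le_mul_of_nonneg_left P.selectProb_le_b₂ (mul_pos P.lam_pos P.M_pos).le

theorem lam_mul_M_mul_selectProb_lt_one (P : RelayParams) (hψ : P.psi ≤ 1)
    (h : ((∀ x, P.overall2 {x} = 0) ∧ (∀ x, P.overall3 {x} = 0)) ∨ P.psi < 1) :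
    P.lam * P.M * P.selectProb < 1 := by
  rcases h with ⟨ha2, ha3⟩ | h
  · have := P.overall2_prob
    have := P.overall3_prob
    have l2 := measureReal_fst_fail_snd_success_lt P.WSD_pos P.WR2D_pos
      (P.overall2_mem.mono fun x hx => hx.2) ha2
    have l3 := measureReal_fst_fail_snd_success_lt P.WSD_pos P.WR2D_pos
      (P.overall3_mem.mono fun x hx => hx.2) ha3
    have c2 : 0 ≤ (P.p .SR2).toReal := ENNReal.toReal_nonneg
    have c3 : 0 ≤ (P.p .P1).toReal + (P.p .P2).toReal + (P.p .P3).toReal := by positivity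
    -- Strictness survives in any term of positive weight; if both weights vanish, R2 is almost
    -- surely never selected.
    have hlt : P.selectProb < P.b₂ ∨ P.selectProb = 0 := by
      rw [selectProb_eq, b₂_eq]
      rcases c2.eq_or_lt with c2 | c2
      · rcases c3.eq_or_lt with c3 | c3
        · right; rw [← c2, ← c3]; ring
        · left
          exact add_lt_add_of_le_of_lt (by rw [← c2]; simp) (mul_lt_mul_of_pos_left l3 c3)
      · left
        exact add_lt_add_of_lt_of_le (mul_lt_mul_of_pos_left l2 c2)
          (mul_le_mul_of_nonneg_left l3.le c3)
    rcases hlt with hlt | hlt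
    · exact (mul_lt_mul_of_pos_left hlt (mul_pos P.lam_pos P.M_pos)).trans_le hψ
    · simp [hlt]
  · exact P.lam_mul_M_mul_selectProb_le.trans_lt h

end RelayParams

/-! ### Absence of a stationary distribution. -/

namespace RelayParams

theorem integrable_harvest (P : RelayParams) : Integrable Slot.harvest P.slotLaw :=
  P.measurePreserving_harvest.integrable_comp_of_integrable (integrable_id_expMeasure P.lam_pos)

theorem integral_harvest (P : RelayParams) : ∫ s, s.harvest ∂P.slotLaw = 1 / P.lam := by
  rw [← integral_id_expMeasure P.lam_pos, ← P.measurePreserving_harvest.map_eq,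
    integral_map measurable_harvest.aemeasurable (by fun_prop)]

theorem step_of_selects (P : RelayParams) {x : ℝ} {s : Slot} (hx : P.M ≤ x)
    (hs : s ∈ P.selectsR2) : P.step x s = x - P.M + s.harvest := if_pos ⟨hx, hs⟩

/-- The increment is a harvest minus a bounded term, hence integrable whatever the law of the level.
-/
theorem step_sub_self (P : RelayParams) (x : ℝ) (s : Slot) :
    P.step x s - x =
      s.harvest - (Set.Ici P.M ×ˢ P.selectsR2).indicator (fun _ => P.M) (x, s) := by
  classical
  have hi : (x, s) ∈ Set.Ici P.M ×ˢ P.selectsR2 ↔ P.M ≤ x ∧ s ∈ P.selectsR2 := Iff.rfl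
  by_cases h : P.M ≤ x ∧ s ∈ P.selectsR2
  · rw [step, if_pos h, Set.indicator_of_mem (hi.2 h)]; ring
  · rw [step, if_neg h, Set.indicator_of_notMem (mt hi.1 h)]; ring

theorem map_step_of_invariant (P : RelayParams) {ν : Measure ℝ} [IsProbabilityMeasure ν]
    (h : Kernel.Invariant P.transition ν) :
    (ν.prod P.slotLaw).map (fun q : ℝ × Slot => P.step q.1 q.2) = ν := by
  conv_rhs => rw [← h]
  ext A hA
  rw [Measure.map_apply P.measurable_step hA, Measure.prod_apply (P.measurable_step hA),
    Measure.bind_apply hA (Kernel.aemeasurable _)]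
  refine lintegral_congr fun x => ?_
  have hm : Measurable (P.step x) := P.measurable_step.comp measurable_prodMk_left
  rw [transition_apply, Measure.map_apply hm hA]
  rfl

/-- In a stationary state the mean harvest equals the mean consumption. -/
theorem mean_balance_of_invariant (P : RelayParams) {ν : Measure ℝ} [IsProbabilityMeasure ν]
    (h : Kernel.Invariant P.transition ν) :
    1 / P.lam = ν.real (Set.Ici P.M) * P.selectProb * P.M := by
  have hm : MeasurableSet (Set.Ici P.M ×ˢ P.selectsR2) :=
    measurableSet_Ici.prod P.measurableSet_selectsR2
  have i1 : Integrable (fun z : ℝ × Slot => z.2.harvest) (ν.prod P.slotLaw) :=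
    P.integrable_harvest.comp_snd ν
  have i2 : Integrable ((Set.Ici P.M ×ˢ P.selectsR2).indicator (fun _ => P.M))
      (ν.prod P.slotLaw) := (integrable_const _).indicator hm
  have he : (fun z : ℝ × Slot => P.step z.1 z.2 - z.1) = fun z =>
      z.2.harvest - (Set.Ici P.M ×ˢ P.selectsR2).indicator (fun _ => P.M) z := by
    ext z; exact P.step_sub_self z.1 z.2
  have h0 := integral_sub_eq_zero_of_map_eq (μ := ν.prod P.slotLaw) (X := Prod.fst)
    (Y := fun z : ℝ × Slot => P.step z.1 z.2) measurable_fst P.measurable_step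
    (by rw [P.map_step_of_invariant h]; exact measurePreserving_fst.map_eq)
    (by rw [he]; exact i1.sub i2)
  rw [he, integral_sub i1 i2, integral_indicator_const _ hm, measureReal_prod_prod,
    integral_fun_snd (fun s : Slot => s.harvest), P.integral_harvest] at h0
  simp only [probReal_univ, smul_eq_mul] at h0
  rw [selectProb]
  linarith

theorem not_exists_invariant (P : RelayParams) (hP : P.lam * P.M * P.selectProb ≤ 1) :
    ¬ ∃ ν : Measure ℝ, IsProbabilityMeasure ν ∧ Kernel.Invariant P.transition ν := by
  rintro ⟨ν, _, h⟩
  have hb := P.mean_balance_of_invariant h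
  have hl := P.lam_pos
  have hM := P.M_pos
  have hq := P.selectProb_nonneg
  have hb' : ν.real (Set.Ici P.M) * (P.lam * P.M * P.selectProb) = 1 := by
    field_simp at hb
    linarith
  have hle : ν.real (Set.Ici P.M) ≤ 1 := measureReal_le_one
  have hone : ν.real (Set.Ici P.M) = 1 := by
    refine le_antisymm hle ?_
    -- 1 = ν[M, ∞) · λMq ≤ ν[M, ∞).
    nlinarith [mul_le_mul_of_nonneg_left hP (measureReal_nonneg (μ := ν) (s := Set.Ici P.M))]
  have hsel : P.slotLaw P.selectsR2 ≠ 0 := fun h0 => by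
    have : P.selectProb = 0 := by simp [selectProb, measureReal_def, h0]
    rw [this] at hb'
    simp at hb'
  have hlow : ν (Set.Iio P.M) = 0 := by
    rw [← Set.compl_Ici, prob_compl_eq_zero_iff measurableSet_Ici]
    rw [measureReal_def, ENNReal.toReal_eq_one_iff] at hone
    exact hone
  -- A stationary mass below `t + M / 2` would leak below `t`.
  have hstep : ∀ t, P.M ≤ t → ν (Set.Iio t) = 0 → ν (Set.Iio (t + P.M / 2)) = 0 := by
    intro t ht h0
    -- Spending M and harvesting less than M / 2 lowers the level by more than M / 2; such slots
    -- have positive probability.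
    have hsub : Set.Ico P.M (t + P.M / 2) ×ˢ
        (P.selectsR2 ∩ Slot.harvest ⁻¹' Set.Iio (P.M / 2)) ⊆
        (fun q : ℝ × Slot => P.step q.1 q.2) ⁻¹' Set.Iio t := by
      rintro ⟨x, s⟩ ⟨hx, hs, hs'⟩
      have h1 : x < t + P.M / 2 := hx.2
      have h2 : s.harvest < P.M / 2 := hs'
      change P.step x s < t
      rw [P.step_of_selects hx.1 hs]
      linarith
    have h1 := measure_mono (μ := ν.prod P.slotLaw) hsub
    rw [← Measure.map_apply P.measurable_step measurableSet_Iio, P.map_step_of_invariant h, h0,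
      Measure.prod_prod, P.slotLaw_selectsR2_inter_harvest measurableSet_Iio, nonpos_iff_eq_zero,
      mul_eq_zero, mul_eq_zero] at h1
    rcases h1 with h1 | h1 | h1
    · refine measure_mono_null ?_ (measure_union_null hlow h1)
      intro x hx
      rcases lt_or_ge x P.M with hx' | hx'
      · exact Or.inl hx'
      · exact Or.inr ⟨hx', hx⟩
    · exact absurd h1 hsel
    · exact absurd h1 (expMeasure_Iio_pos hl (by linarith)).ne'
  have hall : ∀ k : ℕ, ν (Set.Iio (P.M + k * (P.M / 2))) = 0 := by
    intro k
    induction k with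
    | zero => simpa using hlow
    | succ k ih =>
      have := hstep _ (le_add_of_nonneg_right (by positivity)) ih
      convert this using 3
      push_cast
      ring
  have huniv : ν Set.univ = 0 := by
    refine measure_mono_null ?_ (measure_iUnion_null hall)
    intro x _
    obtain ⟨k, hk⟩ := exists_nat_gt (x / (P.M / 2))
    rw [div_lt_iff₀ (by linarith)] at hk
    exact Set.mem_iUnion.2 ⟨k, by simp only [Set.mem_Iio]; linarith⟩
  simp at huniv

end RelayParams

/-! ### A strong law for bounded orthogonal variables. -/

section OrthogonalLaw

variable {Ω : Type*} [MeasurableSpace Ω] {μ : Measure Ω} [IsProbabilityMeasure μ]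
  {d : ℕ → Ω → ℝ}

theorem integrable_of_abs_le_one {f : Ω → ℝ} (hf : Measurable f) (hb : ∀ ω, |f ω| ≤ 1) :
    Integrable f μ :=
  Integrable.of_bound hf.aestronglyMeasurable 1 (ae_of_all _ hb)

theorem integral_sq_sum_le_of_orthogonal (hm : ∀ i, Measurable (d i)) (hb : ∀ i ω, |d i ω| ≤ 1)
    (ho : ∀ i j, i < j → ∫ ω, d i ω * d j ω ∂μ = 0) (n : ℕ) :
    Integrable (fun ω => (∑ i ∈ Finset.range n, d i ω) ^ 2) μ ∧
      ∫ ω, (∑ i ∈ Finset.range n, d i ω) ^ 2 ∂μ ≤ n := by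
  have hmul : ∀ i j, Integrable (fun ω => d i ω * d j ω) μ := fun i j =>
    integrable_of_abs_le_one ((hm i).mul (hm j)) fun ω => by
      rw [abs_mul]; exact mul_le_one₀ (hb i ω) (abs_nonneg _) (hb j ω)
  induction n with
  | zero => simp
  | succ n ih =>
    have e : (fun ω => (∑ i ∈ Finset.range (n + 1), d i ω) ^ 2) = fun ω =>
        (∑ i ∈ Finset.range n, d i ω) ^ 2 +
          (2 * (∑ i ∈ Finset.range n, d i ω * d n ω) + d n ω * d n ω) := by
      ext ω
      rw [Finset.sum_range_succ, ← Finset.sum_mul]; ring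
    have i1 : Integrable (fun ω => 2 * ∑ i ∈ Finset.range n, d i ω * d n ω) μ :=
      (integrable_finsetSum _ fun i _ => hmul i n).const_mul 2
    have z : ∫ ω, 2 * (∑ i ∈ Finset.range n, d i ω * d n ω) ∂μ = 0 := by
      rw [integral_const_mul, integral_finsetSum _ fun i _ => hmul i n,
        Finset.sum_eq_zero fun i hi => ho i n (Finset.mem_range.1 hi), mul_zero]
    have l : ∫ ω, d n ω * d n ω ∂μ ≤ 1 := by
      have : ∫ ω, d n ω * d n ω ∂μ ≤ ∫ _, (1 : ℝ) ∂μ :=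
        integral_mono (hmul n n) (integrable_const _) fun ω => by
          have h := (le_abs_self (d n ω * d n ω))
          rw [abs_mul] at h
          exact h.trans (mul_le_one₀ (hb n ω) (abs_nonneg _) (hb n ω))
      simpa using this
    have i2 : Integrable (fun ω => 2 * (∑ i ∈ Finset.range n, d i ω * d n ω) + d n ω * d n ω) μ :=
      i1.add (hmul n n)
    rw [e]
    refine ⟨ih.1.add i2, ?_⟩
    rw [integral_add ih.1 i2, integral_add i1 (hmul n n), z]
    push_cast
    linarith [ih.2]

theorem abs_sum_range_sub_le {a : ℕ → ℝ} (hb : ∀ i, |a i| ≤ 1) {m n : ℕ} (h : m ≤ n) :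
    |∑ i ∈ Finset.range n, a i| ≤ |∑ i ∈ Finset.range m, a i| + (n - m : ℕ) := by
  rw [← Finset.sum_range_add_sum_Ico a h]
  refine (abs_add_le _ _).trans (add_le_add_right ?_ _)
  refine (Finset.abs_sum_le_sum_abs _ _).trans ((Finset.sum_le_sum fun i _ => hb i).trans ?_)
  simp

theorem tendsto_natSqrt_atTop : Tendsto Nat.sqrt atTop atTop :=
  tendsto_atTop.2 fun b => by
    filter_upwards [eventually_ge_atTop (b * b)] with n hn
    exact Nat.le_sqrt.2 hn

/-- For terms bounded by one, averages along the squares control all averages. -/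
theorem tendsto_average_zero_of_squares {a : ℕ → ℝ} (hb : ∀ i, |a i| ≤ 1)
    (h : Tendsto (fun k : ℕ => (∑ i ∈ Finset.range (k ^ 2), a i) / (k : ℝ) ^ 2) atTop (𝓝 0)) :
    Tendsto (fun n : ℕ => (∑ i ∈ Finset.range n, a i) / n) atTop (𝓝 0) := by
  -- With k = ⌊√n⌋ there are at most 2k terms beyond k², contributing at most 2k / k² to the
  -- average.
  have hk : Tendsto (fun k : ℕ => |(∑ i ∈ Finset.range (k ^ 2), a i) / (k : ℝ) ^ 2| + 2 / k) atTop
      (𝓝 0) := by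
    simpa using h.abs.add (tendsto_const_div_atTop_nhds_zero_nat (2 : ℝ))
  refine squeeze_zero_norm' ?_ (hk.comp tendsto_natSqrt_atTop)
  filter_upwards [eventually_ge_atTop 1] with n hn
  simp only [Function.comp]
  set k := Nat.sqrt n with hkdef
  have hkpos : 0 < k := Nat.sqrt_pos.2 hn
  have hk1 : k ^ 2 ≤ n := Nat.sqrt_le' n
  have hk2 : n - k ^ 2 ≤ 2 * k := by
    have := Nat.sqrt_le_add n
    rw [← hkdef] at this
    have e : k ^ 2 = k * k := sq k
    omega
  have hkR : (0 : ℝ) < k := by exact_mod_cast hkpos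
  have hk1R : (k : ℝ) ^ 2 ≤ n := by exact_mod_cast hk1
  have hk2R : ((n - k ^ 2 : ℕ) : ℝ) ≤ 2 * k := by exact_mod_cast hk2
  rw [Real.norm_eq_abs, abs_div, abs_div, Nat.abs_cast, abs_of_nonneg (sq_nonneg (k : ℝ))]
  calc |∑ i ∈ Finset.range n, a i| / n
      ≤ (|∑ i ∈ Finset.range (k ^ 2), a i| + 2 * k) / (k : ℝ) ^ 2 := by
        gcongr
        exact (abs_sum_range_sub_le hb hk1).trans (by gcongr)
    _ = |∑ i ∈ Finset.range (k ^ 2), a i| / (k : ℝ) ^ 2 + 2 / k := by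
        field_simp

/-- The strong law of large numbers for bounded orthogonal random variables. -/
theorem ae_tendsto_average_zero_of_orthogonal (hm : ∀ i, Measurable (d i))
    (hb : ∀ i ω, |d i ω| ≤ 1) (ho : ∀ i j, i < j → ∫ ω, d i ω * d j ω ∂μ = 0) :
    ∀ᵐ ω ∂μ, Tendsto (fun n : ℕ => (∑ i ∈ Finset.range n, d i ω) / n) atTop (𝓝 0) := by
  let f : ℕ → Ω → ℝ := fun k ω => (∑ i ∈ Finset.range (k ^ 2), d i ω) / (k : ℝ) ^ 2
  have hfm : ∀ k, Measurable (f k) := fun k =>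
    (Finset.measurable_fun_sum _ fun i _ => hm i).div_const _
  have hint : ∀ k, ∫⁻ ω, ENNReal.ofReal (f k ω ^ 2) ∂μ ≤ ENNReal.ofReal (1 / (k : ℝ) ^ 2) := by
    intro k
    obtain ⟨i1, i2⟩ := integral_sq_sum_le_of_orthogonal hm hb ho (k ^ 2)
    have e : (fun ω => f k ω ^ 2) = fun ω =>
        (∑ i ∈ Finset.range (k ^ 2), d i ω) ^ 2 / ((k : ℝ) ^ 2) ^ 2 := by
      ext ω; simp only [f, div_pow]
    rw [← ofReal_integral_eq_lintegral_ofReal (by rw [e]; exact i1.div_const _)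
      (ae_of_all _ fun ω => sq_nonneg _), e, integral_div]
    refine ENNReal.ofReal_le_ofReal ?_
    push_cast at i2
    calc _ ≤ (k : ℝ) ^ 2 / ((k : ℝ) ^ 2) ^ 2 := by gcongr
      _ = 1 / (k : ℝ) ^ 2 := by
        rcases eq_or_ne (k : ℝ) 0 with h0 | h0
        · simp [h0]
        · field_simp
  -- Along the squares the second moments are summable, so almost surely the squared averages are
  -- summable and tend to 0.
  have hsum : ∫⁻ ω, ∑' k, ENNReal.ofReal (f k ω ^ 2) ∂μ ≠ ⊤ := by
    rw [lintegral_tsum fun k => ((hfm k).pow_const 2).ennreal_ofReal.aemeasurable]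
    refine ne_top_of_le_ne_top ?_ (ENNReal.tsum_le_tsum hint)
    have hs : Summable fun k : ℕ => 1 / (k : ℝ) ^ 2 :=
      Real.summable_one_div_nat_pow.2 one_lt_two
    exact hs.tsum_ofReal_ne_top
  have hmeas : Measurable fun ω => ∑' k, ENNReal.ofReal (f k ω ^ 2) :=
    Measurable.tsum fun k => ((hfm k).pow_const 2).ennreal_ofReal
  filter_upwards [ae_lt_top hmeas hsum] with ω hω
  refine tendsto_average_zero_of_squares (fun i => hb i ω) ?_
  have h0 := ENNReal.tendsto_atTop_zero_of_tsum_ne_top hω.ne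
  have h1 : Tendsto (fun k => f k ω ^ 2) atTop (𝓝 0) := by
    have := (ENNReal.tendsto_toReal ENNReal.zero_ne_top).comp h0
    simpa [Function.comp_def, ENNReal.toReal_ofReal, sq_nonneg] using this
  have h2 := h1.sqrt
  simp only [Real.sqrt_sq_eq_abs, Real.sqrt_zero] at h2
  exact (tendsto_zero_iff_abs_tendsto_zero _).2 h2

end OrthogonalLaw

/-! ### Deterministic reflection and occupation estimates. -/

section Occupation

/-- If `b` is the sum of a path `S` of at most linear growth and of pushes `l ≤ M` that occur only
while `b < M`, then the total push grows at most linearly, at the same rate as `S`. -/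
theorem reflection_sum_le {M C ε : ℝ} (hε : 0 ≤ ε) {b l S : ℕ → ℝ}
    (hb : ∀ n, b n = b 0 + S n + ∑ i ∈ Finset.range n, l i)
    (hl : ∀ n, l n ≤ M) (hl0 : ∀ n, M ≤ b n → l n = 0)
    (hS : ∀ n : ℕ, |S n| ≤ ε * n + C) (n : ℕ) :
    ∑ i ∈ Finset.range n, l i ≤ 2 * |M| + |b 0| + C + ε * n := by
  have hC : 0 ≤ C := by simpa using (abs_nonneg _).trans (hS 0)
  induction n with
  | zero => simp; positivity
  | succ n ih =>
    rw [Finset.sum_range_succ]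
    push_cast
    -- If `b n < M`, the past push is `b n - b 0 - S n`, less than |M| + |b 0| + C + εn; the new
    -- push adds at most another |M|.
    rcases le_or_gt M (b n) with h | h
    · rw [hl0 n h]; linarith
    · have h1 := hb n
      have h2 := hS n
      have h3 := neg_abs_le (S n)
      have h4 := neg_abs_le (b 0)
      have h5 := le_abs_self M
      have h6 := hl n
      linarith

theorem exists_abs_le_mul_add {S : ℕ → ℝ} (h : Tendsto (fun n : ℕ => S n / n) atTop (𝓝 0))
    {ε : ℝ} (hε : 0 < ε) : ∃ C, ∀ n : ℕ, |S n| ≤ ε * n + C := by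
  obtain ⟨N, hN⟩ := eventually_atTop.1 (Metric.tendsto_nhds.1 h ε hε)
  -- The range reaches `N`, so that every remaining `n` is positive and can be divided by.
  refine ⟨∑ i ∈ Finset.range (N + 1), |S i|, fun n => ?_⟩
  have hs : 0 ≤ ∑ i ∈ Finset.range (N + 1), |S i| := Finset.sum_nonneg fun i _ => abs_nonneg _
  rcases lt_or_ge n (N + 1) with hn | hn
  · have := Finset.single_le_sum (f := fun i => |S i|) (fun i _ => abs_nonneg _)
      (Finset.mem_range.2 hn)
    have h0 : 0 ≤ ε * n := by positivity
    linarith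
  · have h1 := hN n (by omega)
    have hpos : (0 : ℝ) < n := by exact_mod_cast (by omega : 0 < n)
    rw [Real.dist_eq, sub_zero, abs_div, Nat.abs_cast, div_lt_iff₀ hpos] at h1
    linarith

theorem tendsto_reflection_average {M : ℝ} {b l S : ℕ → ℝ}
    (hb : ∀ n, b n = b 0 + S n + ∑ i ∈ Finset.range n, l i)
    (hl : ∀ n, l n ≤ M) (hl' : ∀ n, 0 ≤ l n) (hl0 : ∀ n, M ≤ b n → l n = 0)
    (hS : Tendsto (fun n : ℕ => S n / n) atTop (𝓝 0)) :
    Tendsto (fun n : ℕ => (∑ i ∈ Finset.range n, l i) / n) atTop (𝓝 0) := by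
  rw [Metric.tendsto_atTop]
  intro ε hε
  obtain ⟨C, hC⟩ := exists_abs_le_mul_add hS (half_pos hε)
  have hbd := reflection_sum_le (half_pos hε).le hb hl hl0 hC
  obtain ⟨N, hN⟩ := exists_nat_gt ((2 * |M| + |b 0| + C) / (ε / 2))
  refine ⟨N + 1, fun n hn => ?_⟩
  have hpos : (0 : ℝ) < n := by exact_mod_cast (by omega : 0 < n)
  have hNn : (N : ℝ) ≤ n := by exact_mod_cast (by omega : N ≤ n)
  rw [Real.dist_eq, sub_zero, abs_of_nonneg
    (div_nonneg (Finset.sum_nonneg fun i _ => hl' i) hpos.le), div_lt_iff₀ hpos]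
  rw [div_lt_iff₀ (half_pos hε)] at hN
  have := mul_le_mul_of_nonneg_right hNn (half_pos hε).le
  linarith [hbd n]

open Classical in
theorem natCard_fin_subtype_eq_sum (p : ℕ → Prop) (n : ℕ) :
    (Nat.card {i : Fin n // p i} : ℝ) = ∑ i ∈ Finset.range n, if p i then (1 : ℝ) else 0 := by
  rw [Nat.card_eq_fintype_card, Fintype.card_subtype, Finset.card_filter,
    Finset.sum_range fun i => if p i then (1 : ℝ) else 0]
  push_cast
  rfl

theorem tendsto_fraction_one_of_eventually {p : ℕ → Prop} (h : ∃ N, ∀ i ≥ N, p i) :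
    Tendsto (fun n : ℕ => (Nat.card {i : Fin n // p i} : ℝ) / n) atTop (𝓝 1) := by
  classical
  have h1 : Tendsto (fun i => if p i then (1 : ℝ) else 0) atTop (𝓝 1) := by
    refine tendsto_const_nhds.congr' ?_
    filter_upwards [eventually_atTop.2 h] with i hi
    simp [hi]
  refine h1.cesaro.congr fun n => ?_
  rw [natCard_fin_subtype_eq_sum, div_eq_inv_mul]

-- The value at index 0 is unconstrained: one index does not affect the limiting average.
open Classical in
theorem tendsto_fraction_gt_one {M : ℝ} {b : ℕ → ℝ} (hne : ∀ n, b (n + 1) ≠ M)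
    (h : Tendsto (fun n : ℕ => (∑ i ∈ Finset.range n, if b i < M then (1 : ℝ) else 0) / n)
      atTop (𝓝 0)) :
    Tendsto (fun n : ℕ => (Nat.card {i : Fin n // M < b i} : ℝ) / n) atTop (𝓝 1) := by
  have e : ∀ i, (if M < b i then (1 : ℝ) else 0) =
      1 - (if b i < M then (1 : ℝ) else 0) - if b i = M then (1 : ℝ) else 0 := fun i => by
    rcases lt_trichotomy (b i) M with hi | hi | hi
    · simp [hi, hi.not_gt, hi.ne]
    · simp [hi]
    · simp [hi, hi.not_gt, hi.ne']
  have h2 : Tendsto (fun n : ℕ => (∑ i ∈ Finset.range n, if b i = M then (1 : ℝ) else 0) / n)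
      atTop (𝓝 0) := by
    have h3 : Tendsto (fun i => if b i = M then (1 : ℝ) else 0) atTop (𝓝 0) := by
      refine tendsto_const_nhds.congr' ?_
      filter_upwards [eventually_ge_atTop 1] with i hi
      obtain ⟨j, rfl⟩ := Nat.exists_eq_add_of_le' hi
      simp [hne j]
    refine h3.cesaro.congr fun n => ?_
    rw [div_eq_inv_mul]
  have h4 := (tendsto_const_nhds (x := (1 : ℝ)).sub h).sub h2
  rw [sub_zero, sub_zero] at h4
  refine h4.congr' ?_
  filter_upwards [eventually_ge_atTop 1] with n hn
  have hpos : (0 : ℝ) < n := by exact_mod_cast hn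
  rw [natCard_fin_subtype_eq_sum (fun i => M < b i)]
  simp only [e, Finset.sum_sub_distrib]
  field_simp
  simp

end Occupation

/-! ### Paths of the buffer level. -/

namespace RelayParams

/-- The net energy gain in a slot if the buffer is full enough. -/
noncomputable def netGain (P : RelayParams) (s : Slot) : ℝ :=
  s.harvest - P.selectsR2.indicator (fun _ => P.M) s

theorem measurable_netGain (P : RelayParams) : Measurable P.netGain :=
  measurable_harvest.sub (measurable_const.indicator P.measurableSet_selectsR2)

theorem integrable_netGain (P : RelayParams) : Integrable P.netGain P.slotLaw :=
  P.integrable_harvest.sub ((integrable_const _).indicator P.measurableSet_selectsR2)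

theorem integral_netGain (P : RelayParams) :
    ∫ s, P.netGain s ∂P.slotLaw = 1 / P.lam - P.selectProb * P.M := by
  unfold netGain
  rw [integral_sub P.integrable_harvest
    ((integrable_const _).indicator P.measurableSet_selectsR2), P.integral_harvest,
    integral_indicator_const _ P.measurableSet_selectsR2]
  rfl

-- The last term refunds the M that `netGain` charges for a selection which the low buffer cannot
-- serve.
open Classical in
theorem step_eq_add_netGain_add (P : RelayParams) (x : ℝ) (s : Slot) :
    P.step x s = x + P.netGain s + if x < P.M ∧ s ∈ P.selectsR2 then P.M else 0 := by
  unfold step netGain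
  by_cases hs : s ∈ P.selectsR2
  · rcases le_or_gt P.M x with hx | hx
    · simp [hs, hx, hx.not_gt]; ring
    · simp [hs, hx, hx.not_ge]; ring
  · simp [hs]

/-- The harvest would have to take one of two values, and its law has no atoms. -/
theorem slotLaw_step_eq (P : RelayParams) (x y : ℝ) : P.slotLaw {s | P.step x s = y} = 0 := by
  have := nullSingletonClass_expMeasure P.lam
  have hz : ∀ c, P.slotLaw (Slot.harvest ⁻¹' {c}) = 0 := fun c => by
    rw [P.measurePreserving_harvest.measure_preimage (measurableSet_singleton c).nullMeasurableSet]
    exact measure_singleton c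
  refine measure_mono_null ?_ (measure_union_null (hz (y - x + P.M)) (hz (y - x)))
  intro s hs
  have hs : P.step x s = y := hs
  unfold step at hs
  split_ifs at hs
  · left; simp only [Set.mem_preimage, Set.mem_singleton_iff]; linarith
  · right; simp only [Set.mem_preimage, Set.mem_singleton_iff]; linarith

namespace IsBufferEvolution

variable {P : RelayParams} {Ω : Type*} [MeasurableSpace Ω] {μ : Measure Ω}
  {B : ℕ → Ω → ℝ} {ξ : ℕ → Ω → Slot}

theorem measurable_level (h : P.IsBufferEvolution μ B ξ) (i : ℕ) : Measurable (B i) := by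
  induction i with
  | zero => exact h.measurable_init
  | succ i ih =>
    have : B (i + 1) = fun ω => P.step (B i ω) (ξ i ω) := funext (h.update i)
    rw [this]
    exact P.measurable_step.comp (ih.prodMk (h.measurable_slot i))

theorem exists_slot_eq_comp_past {Ω : Type*} {B : ℕ → Ω → ℝ} {ξ : ℕ → Ω → Slot} {i j : ℕ} (hj : j < i) :
    ∃ g : ℝ × (Finset.range i → Slot) → Slot, Measurable g ∧
      ξ j = fun ω => g (B 0 ω, fun j : Finset.range i => ξ j ω) :=
  ⟨fun z => z.2 ⟨j, Finset.mem_range.2 hj⟩, by fun_prop, rfl⟩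

/-- Expressing several levels through one common past makes them jointly independent of slot `i`. -/
theorem exists_level_eq_comp_past (h : P.IsBufferEvolution μ B ξ) {i k : ℕ} (hk : k ≤ i) :
    ∃ g : ℝ × (Finset.range i → Slot) → ℝ, Measurable g ∧
      B k = fun ω => g (B 0 ω, fun j : Finset.range i => ξ j ω) := by
  induction k with
  | zero => exact ⟨Prod.fst, measurable_fst, rfl⟩
  | succ k ih =>
    obtain ⟨g, hg, hgB⟩ := ih (by omega)
    obtain ⟨g', hg', hgξ⟩ := exists_slot_eq_comp_past (B := B) (ξ := ξ) (i := i) (j := k) (by omega)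
    refine ⟨fun z => P.step (g z) (g' z), P.measurable_step.comp (hg.prodMk hg'), ?_⟩
    ext ω
    rw [h.update, congrFun hgB ω, congrFun hgξ ω]

theorem ae_tendsto_average_netGain (h : P.IsBufferEvolution μ B ξ) :
    ∀ᵐ ω ∂μ, Tendsto (fun n : ℕ => (∑ i ∈ Finset.range n, P.netGain (ξ i ω)) / n) atTop
      (𝓝 (1 / P.lam - P.selectProb * P.M)) := by
  have hid : ∀ i, IdentDistrib (ξ i) (ξ 0) μ μ := fun i =>
    ⟨(h.measurable_slot i).aemeasurable, (h.measurable_slot 0).aemeasurable,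
      by rw [h.law_slot, h.law_slot]⟩
  have hint : Integrable (fun ω => P.netGain (ξ 0 ω)) μ := by
    have := P.integrable_netGain
    rw [← h.law_slot 0] at this
    exact this.comp_measurable (h.measurable_slot 0)
  have hsl := strong_law_ae_real (μ := μ) (fun i ω => P.netGain (ξ i ω)) hint
    (fun i j hij => (h.indep_slots.indepFun hij).comp P.measurable_netGain P.measurable_netGain)
    (fun i => (hid i).comp P.measurable_netGain)
  have e : ∫ ω, P.netGain (ξ 0 ω) ∂μ = 1 / P.lam - P.selectProb * P.M := by
    rw [← P.integral_netGain, ← h.law_slot 0, integral_map (h.measurable_slot 0).aemeasurable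
      P.measurable_netGain.aestronglyMeasurable]
  rw [e] at hsl
  exact hsl

open Classical in
theorem level_eq (h : P.IsBufferEvolution μ B ξ) (ω : Ω) (n : ℕ) :
    B n ω = B 0 ω + ∑ i ∈ Finset.range n, P.netGain (ξ i ω) +
      ∑ i ∈ Finset.range n, if B i ω < P.M ∧ ξ i ω ∈ P.selectsR2 then P.M else 0 := by
  induction n with
  | zero => simp
  | succ n ih =>
    rw [h.update, step_eq_add_netGain_add, Finset.sum_range_succ, Finset.sum_range_succ]
    linarith

/-- Refunds are nonnegative, so the level dominates a random walk of positive drift. -/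
theorem ae_eventually_gt (h : P.IsBufferEvolution μ B ξ)
    (hP : P.lam * P.M * P.selectProb < 1) :
    ∀ᵐ ω ∂μ, ∃ N : ℕ, ∀ i ≥ N, P.M < B i ω := by
  classical
  have hc : 0 < 1 / P.lam - P.selectProb * P.M := by
    rw [sub_pos, lt_div_iff₀ P.lam_pos]; linarith
  filter_upwards [h.ae_tendsto_average_netGain] with ω hω
  have hinf : Tendsto (fun n : ℕ => ∑ i ∈ Finset.range n, P.netGain (ξ i ω)) atTop atTop := by
    refine (hω.pos_mul_atTop hc tendsto_natCast_atTop_atTop).congr' ?_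
    filter_upwards [eventually_ge_atTop 1] with n hn
    have hpos : (0 : ℝ) < n := by exact_mod_cast hn
    field_simp
  refine eventually_atTop.1 ?_
  filter_upwards [hinf.eventually_gt_atTop (P.M - B 0 ω)] with n hn
  have hM := P.M_pos.le
  have h0 : 0 ≤ ∑ i ∈ Finset.range n, if B i ω < P.M ∧ ξ i ω ∈ P.selectsR2 then P.M else 0 :=
    Finset.sum_nonneg fun i _ => by positivity
  rw [h.level_eq ω n]
  linarith

variable [IsProbabilityMeasure μ]

theorem indepFun_past_slot (h : P.IsBufferEvolution μ B ξ) (i : ℕ) :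
    IndepFun (fun ω => (B 0 ω, fun j : Finset.range i => ξ j ω)) (ξ i) μ := by
  have h2 : IndepFun (fun ω (j : Finset.range i) => ξ j ω) (ξ i) μ := by
    have h3 := h.indep_slots.indepFun_finset (Finset.range i) {i} (by simp) h.measurable_slot
    exact h3.comp (ψ := fun v : ({i} : Finset ℕ) → Slot => v ⟨i, by simp⟩)
      measurable_id (measurable_pi_apply _)
  have h1 : IndepFun (B 0) (fun ω => ((fun j : Finset.range i => ξ j ω), ξ i ω)) μ :=
    h.indep_init.comp (ψ := fun v : ℕ → Slot => ((fun j : Finset.range i => v j), v i))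
      measurable_id (by fun_prop)
  exact indepFun_prodMk_left h.measurable_init
    (measurable_pi_lambda _ fun j => h.measurable_slot j) (h.measurable_slot i) h1 h2

theorem indepFun_level_slot (h : P.IsBufferEvolution μ B ξ) (i : ℕ) :
    IndepFun (B i) (ξ i) μ := by
  obtain ⟨g, hg, e⟩ := h.exists_level_eq_comp_past le_rfl
  rw [e]
  exact (h.indepFun_past_slot i).comp hg measurable_id

theorem indepFun_levels_slot (h : P.IsBufferEvolution μ B ξ) {i j : ℕ} (hij : i < j) :
    IndepFun (fun ω => (B i ω, ξ i ω, B j ω)) (ξ j) μ := by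
  obtain ⟨g₁, hg₁, e₁⟩ := h.exists_level_eq_comp_past hij.le
  obtain ⟨g₂, hg₂, e₂⟩ := h.exists_level_eq_comp_past (le_refl j)
  obtain ⟨g₃, hg₃, e₃⟩ := exists_slot_eq_comp_past (B := B) (ξ := ξ) hij
  have := (h.indepFun_past_slot j).comp (hg₁.prodMk (hg₃.prodMk hg₂)) measurable_id
  have e : (fun ω => (B i ω, ξ i ω, B j ω)) = (fun a => (g₁ a, g₃ a, g₂ a)) ∘
      fun ω => (B 0 ω, fun j : Finset.range j => ξ j ω) := by
    ext1 ω
    simp only [Function.comp, ← congrFun e₁ ω, ← congrFun e₂ ω, ← congrFun e₃ ω]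
  rw [e]
  exact this

/-- Slot 0 is left out because the law of the initial level may have atoms. -/
theorem ae_level_succ_ne (h : P.IsBufferEvolution μ B ξ) (y : ℝ) :
    ∀ᵐ ω ∂μ, ∀ i, B (i + 1) ω ≠ y := by
  rw [ae_all_iff]
  intro i
  have hS : MeasurableSet {q : ℝ × Slot | P.step q.1 q.2 = y} :=
    P.measurable_step (measurableSet_singleton y)
  have hmap := (indepFun_iff_map_prod_eq_prod_map_map (h.measurable_level i).aemeasurable
    (h.measurable_slot i).aemeasurable).1 (h.indepFun_level_slot i)
  have h0 : μ ((fun ω => (B i ω, ξ i ω)) ⁻¹' {q : ℝ × Slot | P.step q.1 q.2 = y}) = 0 := by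
    rw [← Measure.map_apply ((h.measurable_level i).prodMk (h.measurable_slot i)) hS, hmap,
      h.law_slot, Measure.measure_prod_null hS]
    exact ae_of_all _ fun x => P.slotLaw_step_eq x y
  rw [ae_iff]
  refine measure_mono_null (fun ω hω => ?_) h0
  have hω : ¬ B (i + 1) ω ≠ y := hω
  rw [not_not, h.update] at hω
  exact hω

open Classical in
/-- Selections in slots with a low buffer occur at rate `selectProb`. -/
theorem ae_tendsto_low_selection (h : P.IsBufferEvolution μ B ξ) :
    ∀ᵐ ω ∂μ, Tendsto (fun n : ℕ => (∑ i ∈ Finset.range n,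
      (if B i ω < P.M then (1 : ℝ) else 0) *
        (P.selectsR2.indicator (fun _ => (1 : ℝ)) (ξ i ω) - P.selectProb)) / n) atTop (𝓝 0) := by
  have hq0 := P.selectProb_nonneg
  have hq1 : P.selectProb ≤ 1 := measureReal_le_one
  have hL : Measurable fun x : ℝ => if x < P.M then (1 : ℝ) else 0 :=
    Measurable.ite measurableSet_Iio measurable_const measurable_const
  have hR : Measurable fun s : Slot =>
      P.selectsR2.indicator (fun _ => (1 : ℝ)) s - P.selectProb :=
    (measurable_const.indicator P.measurableSet_selectsR2).sub_const _
  have hR0 : ∀ j, ∫ ω, (P.selectsR2.indicator (fun _ => (1 : ℝ)) (ξ j ω) - P.selectProb) ∂μ = 0 :=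
    fun j => by
      rw [← integral_map (h.measurable_slot j).aemeasurable hR.aestronglyMeasurable, h.law_slot,
        integral_sub ((integrable_const _).indicator P.measurableSet_selectsR2)
          (integrable_const _), integral_indicator_const _ P.measurableSet_selectsR2]
      simp [selectProb]
  refine ae_tendsto_average_zero_of_orthogonal
    (fun i => (hL.comp (h.measurable_level i)).mul (hR.comp (h.measurable_slot i)))
    (fun i ω => ?_) (fun i j hij => ?_)
  · rw [abs_mul]
    refine mul_le_one₀ (by split_ifs <;> simp) (abs_nonneg _) ?_
    by_cases hs : ξ i ω ∈ P.selectsR2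
    · rw [Set.indicator_of_mem hs, abs_le]; constructor <;> linarith
    · rw [Set.indicator_of_notMem hs, abs_le]; constructor <;> linarith
  -- For i < j the product of the two terms is a function of the past of slot j times the centred
  -- selection in slot j, which is independent of that past.
  · have hW : Measurable fun z : ℝ × Slot × ℝ => (if z.1 < P.M then (1 : ℝ) else 0) *
        (P.selectsR2.indicator (fun _ => (1 : ℝ)) z.2.1 - P.selectProb) *
        (if z.2.2 < P.M then (1 : ℝ) else 0) :=
      ((hL.comp measurable_fst).mul (hR.comp (measurable_fst.comp measurable_snd))).mul
        (hL.comp (measurable_snd.comp measurable_snd))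
    have hind := (h.indepFun_levels_slot hij).comp hW hR
    have hbi := h.measurable_level i
    have hbj := h.measurable_level j
    have hsi := h.measurable_slot i
    have := hind.integral_fun_mul_eq_mul_integral
      (hW.comp (hbi.prodMk (hsi.prodMk hbj))).aestronglyMeasurable
      (hR.comp (h.measurable_slot j)).aestronglyMeasurable
    simp only [Function.comp, hR0 j, mul_zero] at this
    refine Eq.trans (integral_congr_ae (ae_of_all _ fun ω => ?_)) this
    simp only
    ring

theorem ae_tendsto_fraction_of_critical (h : P.IsBufferEvolution μ B ξ)
    (hP : P.lam * P.M * P.selectProb = 1) :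
    ∀ᵐ ω ∂μ, Tendsto (fun n : ℕ => (Nat.card {i : Fin n // P.M < B i ω} : ℝ) / n)
      atTop (𝓝 1) := by
  classical
  have hl := P.lam_pos
  have hM := P.M_pos
  have hc : 1 / P.lam - P.selectProb * P.M = 0 := by
    rw [sub_eq_zero, div_eq_iff hl.ne']; linarith
  have hq : P.selectProb ≠ 0 := fun h0 => by simp [h0] at hP
  filter_upwards [h.ae_tendsto_average_netGain, h.ae_tendsto_low_selection,
    h.ae_level_succ_ne P.M] with ω h1 h2 h3
  rw [hc] at h1
  have h4 := tendsto_reflection_average (M := P.M) (b := fun n => B n ω) (h.level_eq ω)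
    (fun n => by split_ifs <;> linarith) (fun n => by split_ifs <;> linarith)
    (fun n hn => if_neg fun hn' => hn.not_gt hn'.1) h1
  refine tendsto_fraction_gt_one (b := fun n => B n ω) h3 ?_
  -- Refunds divided by M count the low selections; subtracting the centred sum leaves q times the
  -- number of low slots.
  have h5 := ((h4.const_mul (1 / P.M)).sub h2).const_mul (1 / P.selectProb)
  simp only [mul_zero, sub_zero] at h5
  refine h5.congr fun n => ?_
  have e : ∀ i, (if B i ω < P.M then (1 : ℝ) else 0) *
      (P.selectsR2.indicator (fun _ => (1 : ℝ)) (ξ i ω) - P.selectProb) =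
      1 / P.M * (if B i ω < P.M ∧ ξ i ω ∈ P.selectsR2 then P.M else 0) -
        P.selectProb * if B i ω < P.M then (1 : ℝ) else 0 := fun i => by
    by_cases hb : B i ω < P.M <;> by_cases hs : ξ i ω ∈ P.selectsR2 <;> simp [hb, hs, hM.ne']
  simp only [e, Finset.sum_sub_distrib, ← Finset.mul_sum]
  field_simp
  ring

end IsBufferEvolution

end RelayParams

/-- If `ψ_{R2} ≤ 1`, the buffer level of R2 has no stationary distribution. It almost surely
exceeds `M` from some finite slot on, if the accumulated SNRs have continuous distributions or
`ψ_{R2} < 1`; and without either proviso it almost surely exceeds `M` in almost all slots. -/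
theorem theorem2 (P : RelayParams) (hψ : P.psi ≤ 1) :
    (¬ ∃ ν : Measure ℝ, IsProbabilityMeasure ν ∧ Kernel.Invariant P.transition ν) ∧
    ∀ {Ω : Type*} [MeasurableSpace Ω] (μ : Measure Ω) [IsProbabilityMeasure μ]
      (B : ℕ → Ω → ℝ) (ξ : ℕ → Ω → Slot), P.IsBufferEvolution μ B ξ →
      (((∀ x, P.overall2 {x} = 0) ∧ (∀ x, P.overall3 {x} = 0)) ∨ P.psi < 1 →
        ∀ᵐ ω ∂μ, ∃ N : ℕ, ∀ i ≥ N, P.M < B i ω) ∧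
      ∀ᵐ ω ∂μ, Tendsto
        (fun n : ℕ => (Nat.card {i : Fin n // P.M < B i ω} : ℝ) / n) atTop (𝓝 1) := by
  have hP : P.lam * P.M * P.selectProb ≤ 1 := P.lam_mul_M_mul_selectProb_le.trans hψ
  refine ⟨P.not_exists_invariant hP, fun μ _ B ξ h =>
    ⟨fun h' => h.ae_eventually_gt (P.lam_mul_M_mul_selectProb_lt_one hψ h'), ?_⟩⟩
  -- The split is on λMq, not on ψ: ψ = 1 can still mean positive drift.
  rcases hP.lt_or_eq with hlt | heq
  · filter_upwards [h.ae_eventually_gt hlt] with ω hω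
    exact tendsto_fraction_one_of_eventually (p := fun i => P.M < B i ω) hω
  · exact h.ae_tendsto_fraction_of_critical heq
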